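/- Partitions. For $k,l\in\mathbb N_0$ let $\mathcal P(k,l)$ be the set of partitions $p$ of a row of $k$ upper points and a row of $l$ lower points (both numbered from left to right) into blocks. Points in the same block are called connected. The tensor product $p\otimes q$ is horizontal concatenation; the involution $p^*$ exchanges the two rows; the composition $t\circ s\in\mathcal P(k,m)$ of $s\in\mathcal P(k,l)$ and $t\in\mathcal P(l,m)$ is obtained by placing $s$ on top of $t$, identifying the lower points of $s$ with the upper points of $t$, joining connected blocks and erasing the middle points (and with them all blocks that contain only middle points). A partition is non-crossing if, when the points are listed cyclically (upper row from left to right, then lower row from right to left), there are no four points $a<b<c<d$ with $a,c$ in one block and $b,d$ in another block. A category of partitions $\mathcal C$ is a set of partitions which contains the identity partition (the one-block partition in $\mathcal P(1,1)$) and the two pair partitions (the one-block partitions in $\mathcal P(0,2)$ and $\mathcal P(2,0)$) and which is closed under composition, involution and tensor products. Put $\mathcal C(k,l)=\mathcal C\cap\mathcal P(k,l)$. The category $\mathcal C$ is called non-crossing if all its elements are non-crossing. Maps. Let $N\in\mathbb N$ and let $e_1,\dots,e_N$ be the canonical basis of $\mathbb C^N$. For $p\in\mathcal P(k,l)$ define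 the linear map $$T_p:(\mathbb C^N)^{\otimes k}\to(\mathbb C^N)^{\otimes l},\qquad e_{i_1}\otimes\cdots\otimes e_{i_k}\mapsto\sum_{j_1,\dots,j_l=1}^N\delta_p(i,j)\,e_{j_1}\otimes\cdots\otimes e_{j_l},$$ where $\delta_p(i,j)=1$ if labelling the upper points by $i$ and the lower points by $j$ gives equal labels to connected points, and $\delta_p(i,j)=0$ otherwise. Let $R_N(\mathcal C)$ be the family of operator spaces $$\operatorname{Hom}_{\mathcal C}(k,l)=\operatorname{span}\{T_p\mid p\in\mathcal C(k,l)\},\qquad k,l\in\mathbb N_0 .$$ Quantum groups. An orthogonal compact matrix quantum group of size $N$ is a pair $G=(A,u)$ of a unital $C^*$-algebra $A$ and an invertible matrix $u=(u_{ij})\in M_N(A)$ with self-adjoint entries that generate $A$ as a $C^*$-algebra, such that there is a unital $*$-homomorphism $\Delta:A\to A\otimes A$ (minimal tensor product) with $\Delta(u_{ij})=\sum_k u_{ik}\otimes u_{kj}$. Its intertwiner spaces are $$\operatorname{Hom}_G(k,l)=\{T:(\mathbb C^N)^{\otimes k}\to(\mathbb C^N)^{\otimes l}\text{ linear}\mid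 Tu^{\otimes k}=u^{\otimes l}T\},$$ where $u^{\otimes k}$ has the entries $u_{i_1j_1}\cdots u_{i_kj_k}$. Two such quantum groups of size $N$ are considered the same if all their intertwiner spaces coincide. We say that $G$ is the easy quantum group $G_N(\mathcal C)$ if $\operatorname{Hom}_G(k,l)=\operatorname{Hom}_{\mathcal C}(k,l)$ for all $k,l\in\mathbb N_0$; it is called free if $\mathcal C$ is non-crossing. Theorem. Let $N\ge 4$. The map $\mathcal C\mapsto R_N(\mathcal C)$ is injective on the set of non-crossing categories of partitions. Consequently, different non-crossing categories give different free easy quantum groups: if $\mathcal C_1\neq\mathcal C_2$ are non-crossing categories of partitions, $G_1$ is the easy quantum group $G_N(\mathcal C_1)$ and $G_2$ is the easy quantum group $G_N(\mathcal C_2)$, then $G_1$ and $G_2$ are not the same. -/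

import Mathlib

open scoped TensorProduct

universe u v

noncomputable section

namespace EasyQG

/-! ### Partitions -/

/-- A partition on `k` upper points (`Sum.inl`) and `l` lower points (`Sum.inr`), both numbered
from left to right, given by the equivalence relation whose classes are the blocks. -/
abbrev Partition (k l : ℕ) : Type := Setoid (Fin k ⊕ Fin l)

namespace Partition

/-- The points in the cyclic order of the boundary of the strip: the upper row from left to right,
followed by the lower row from right to left. -/
def pos {k l : ℕ} : Fin k ⊕ Fin l → ℕ
  | Sum.inl a => a
  | Sum.inr b => k + (Fin.rev b : ℕ)

/-- A partition is non-crossing if no two different blocks cross: whenever four points in cyclic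
order are such that the first is connected with the third and the second with the fourth, then
they all lie in one block. -/
def IsNonCrossing {k l : ℕ} (p : Partition k l) : Prop :=
  ∀ a b c d : Fin k ⊕ Fin l, pos a < pos b → pos b < pos c → pos c < pos d →
    p a c → p b d → p a b

/-- The disjoint union of two equivalence relations. -/
def sumSetoid {α β : Type} (r : Setoid α) (s : Setoid β) : Setoid (α ⊕ β) where
  r := Sum.LiftRel r s
  iseqv :=
    { refl := by
        rintro (a | b)
        · exact .inl (r.refl a)
        · exact .inr (s.refl b)
      symm := by
        rintro _ _ (h | h)
        · exact .inl (r.symm h)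
        · exact .inr (s.symm h)
      trans := by
        rintro _ _ _ (h | h) (h' | h')
        · exact .inl (r.trans h h')
        · exact .inr (s.trans h h') }

/-- The points of the horizontal concatenation, sorted into those of the left and those of the
right partition. -/
def tensorPoints (k l k' l' : ℕ) :
    Fin (k + k') ⊕ Fin (l + l') ≃ (Fin k ⊕ Fin l) ⊕ (Fin k' ⊕ Fin l') :=
  (Equiv.sumCongr finSumFinEquiv.symm finSumFinEquiv.symm).trans
    (Equiv.sumSumSumComm (Fin k) (Fin k') (Fin l) (Fin l'))

/-- The tensor product `p ⊗ q`: horizontal concatenation, `p` to the left of `q`. -/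
@[reducible]
def tensor {k l k' l' : ℕ} (p : Partition k l) (q : Partition k' l') :
    Partition (k + k') (l + l') :=
  (sumSetoid p q).comap (tensorPoints k l k' l')

/-- The involution `p ↦ p*`: exchange of the two rows. -/
@[reducible]
def invol {k l : ℕ} (p : Partition k l) : Partition l k :=
  p.comap Sum.swap

/-- Connections inside the picture of `s` placed on top of `t`: three rows of points (upper,
middle, lower), with the lower points of `s` identified with the upper points of `t`. -/
inductive StackRel {k l m : ℕ} (t : Partition l m) (s : Partition k l) :
    Fin k ⊕ Fin l ⊕ Fin m → Fin k ⊕ Fin l ⊕ Fin m → Prop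
  | top (x y : Fin k ⊕ Fin l) (h : s x y) :
      StackRel t s (Sum.map id Sum.inl x) (Sum.map id Sum.inl y)
  | bottom (x y : Fin l ⊕ Fin m) (h : t x y) : StackRel t s (Sum.inr x) (Sum.inr y)

/-- The composition `t ∘ s`: vertical concatenation, `s` on top of `t`, followed by erasing the
middle points (and with them the remaining loops). -/
@[reducible]
def comp {k l m : ℕ} (t : Partition l m) (s : Partition k l) : Partition k m :=
  (Relation.EqvGen.setoid (StackRel t s)).comap (Sum.map id Sum.inr)

end Partition

/-- A category of partitions: a set of partitions (given by its parts `C(k, l)`) that contains the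
identity partition and the two pair partitions (each has one block, containing its two points) and
is closed under composition, involution and tensor products. -/
@[ext]
structure PartitionCategory where
  mem : (k l : ℕ) → Set (Partition k l)
  id_mem : (⊤ : Partition 1 1) ∈ mem 1 1
  lower_pair_mem : (⊤ : Partition 0 2) ∈ mem 0 2
  upper_pair_mem : (⊤ : Partition 2 0) ∈ mem 2 0
  comp_mem : ∀ {k l m : ℕ} {t : Partition l m} {s : Partition k l},
    t ∈ mem l m → s ∈ mem k l → t.comp s ∈ mem k m
  invol_mem : ∀ {k l : ℕ} {p : Partition k l}, p ∈ mem k l → p.invol ∈ mem l k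
  tensor_mem : ∀ {k l k' l' : ℕ} {p : Partition k l} {q : Partition k' l'},
    p ∈ mem k l → q ∈ mem k' l' → p.tensor q ∈ mem (k + k') (l + l')

/-- A category of partitions is non-crossing if all its elements are. -/
def PartitionCategory.IsNonCrossing (C : PartitionCategory) : Prop :=
  ∀ (k l : ℕ), ∀ p ∈ C.mem k l, p.IsNonCrossing

/-! ### The maps `T_p` and their spans -/

/-- The tensor power `(ℂ^N)^{⊗ k}`. -/
abbrev TPow (N k : ℕ) : Type := ⨂[ℂ] _ : Fin k, EuclideanSpace ℂ (Fin N)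

/-- The basis `e_{i_1} ⊗ ⋯ ⊗ e_{i_k}` of `(ℂ^N)^{⊗ k}`. -/
def tBasis (N k : ℕ) : Module.Basis (Fin k → Fin N) ℂ (TPow N k) :=
  Basis.piTensorProduct fun _ => (EuclideanSpace.basisFun (Fin N) ℂ).toBasis

/-- `(i, j)` is a valid labelling of `p`: connected points have equal labels. -/
def Partition.IsValid {k l : ℕ} (p : Partition k l) {N : ℕ} (i : Fin k → Fin N)
    (j : Fin l → Fin N) : Prop :=
  ∀ x y : Fin k ⊕ Fin l, p x y → Sum.elim i j x = Sum.elim i j y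

open Classical in
/-- `δ_p(i, j)`, as a complex number. -/
def Partition.delta {k l : ℕ} (p : Partition k l) {N : ℕ} (i : Fin k → Fin N)
    (j : Fin l → Fin N) : ℂ :=
  if p.IsValid i j then 1 else 0

/-- The linear map `T_p : e_i ↦ ∑_j δ_p(i, j) e_j`. -/
def Partition.T (N : ℕ) {k l : ℕ} (p : Partition k l) : TPow N k →ₗ[ℂ] TPow N l :=
  (tBasis N k).constr ℂ fun i => ∑ j : Fin l → Fin N, p.delta i j • tBasis N l j

/-- Families of spaces of linear maps `(ℂ^N)^{⊗ k} → (ℂ^N)^{⊗ l}`, `k, l ∈ ℕ`. -/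
abbrev OperatorSpaces (N : ℕ) : Type :=
  (k l : ℕ) → Submodule ℂ (TPow N k →ₗ[ℂ] TPow N l)

/-- `R_N(C)`: the morphism spaces `Hom(k, l) = span {T_p | p ∈ C(k, l)}`. -/
def R (N : ℕ) (C : PartitionCategory) : OperatorSpaces N :=
  fun k l => Submodule.span ℂ (Partition.T N '' C.mem k l)

/-! ### Orthogonal compact matrix quantum groups -/

/-- A faithful unital representation of a unital C⋆-algebra on a Hilbert space. -/
structure FaithfulRep (A : Type u) [CStarAlgebra A] where
  H : Type u
  [normed : NormedAddCommGroup H]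
  [inner : InnerProductSpace ℂ H]
  [complete : CompleteSpace H]
  rep : A →⋆ₐ[ℂ] (H →L[ℂ] H)
  injective : Function.Injective rep

attribute [instance] FaithfulRep.normed FaithfulRep.inner FaithfulRep.complete

namespace FaithfulRep

variable {A : Type u} [CStarAlgebra A]

/-- The Hilbert space tensor product of the representation space with itself. -/
def HH (π : FaithfulRep A) : Type u := UniformSpace.Completion (π.H ⊗[ℂ] π.H)

instance (π : FaithfulRep A) : NormedAddCommGroup π.HH :=
  inferInstanceAs (NormedAddCommGroup (UniformSpace.Completion (π.H ⊗[ℂ] π.H)))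

instance (π : FaithfulRep A) : InnerProductSpace ℂ π.HH :=
  inferInstanceAs (InnerProductSpace ℂ (UniformSpace.Completion (π.H ⊗[ℂ] π.H)))

instance (π : FaithfulRep A) : CompleteSpace π.HH :=
  inferInstanceAs (CompleteSpace (UniformSpace.Completion (π.H ⊗[ℂ] π.H)))

/-- The operator `π(a) ⊗ π(b)` on the Hilbert space tensor product. -/
def op (π : FaithfulRep A) (a b : A) : π.HH →L[ℂ] π.HH :=
  ContinuousLinearMap.completion (TensorProduct.mapL (π.rep a) (π.rep b))

/-- The minimal (spatial) C⋆-tensor product `A ⊗ A`, realised through the faithful representation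
as the C⋆-algebra of operators generated by the `π(a) ⊗ π(b)`. -/
def minTensor (π : FaithfulRep A) : StarSubalgebra ℂ (π.HH →L[ℂ] π.HH) :=
  (StarAlgebra.adjoin ℂ (Set.range fun ab : A × A => π.op ab.1 ab.2)).topologicalClosure

/-- The elementary tensor `a ⊗ b` as an element of `A ⊗ A`. -/
def tmul (π : FaithfulRep A) (a b : A) : π.minTensor :=
  ⟨π.op a b, StarSubalgebra.le_topologicalClosure _ (StarAlgebra.subset_adjoin ℂ _ ⟨(a, b), rfl⟩)⟩

end FaithfulRep

/-- An orthogonal compact matrix quantum group of size `N`: a unital C⋆-algebra `A` with an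
`N × N` matrix `u` over it. -/
structure OrthogonalCMQG (N : ℕ) where
  A : Type u
  [cstar : CStarAlgebra A]
  u : Matrix (Fin N) (Fin N) A
  /-- the entries of `u` generate `A` as a C⋆-algebra -/
  generate : (StarAlgebra.adjoin ℂ
    (Set.range fun ij : Fin N × Fin N => u ij.1 ij.2)).topologicalClosure = ⊤
  invertible : IsUnit u
  selfAdjoint : ∀ i j, IsSelfAdjoint (u i j)
  /-- there is a comultiplication `Δ : A → A ⊗ A` with `Δ(u_ij) = ∑_k u_ik ⊗ u_kj` -/
  comul : ∃ (π : FaithfulRep A) (Δ : A →⋆ₐ[ℂ] π.minTensor),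
    ∀ i j, Δ (u i j) = ∑ k, π.tmul (u i k) (u k j)

attribute [instance] OrthogonalCMQG.cstar

namespace OrthogonalCMQG

variable {N : ℕ}

/-- The tensor power `u^{⊗ k}`, as a matrix over `A` indexed by the basis of `(ℂ^N)^{⊗ k}`: the
entry at `(i, j)` is `u_{i_1 j_1} ⋯ u_{i_k j_k}`. -/
def uPow (G : OrthogonalCMQG N) (k : ℕ) : Matrix (Fin k → Fin N) (Fin k → Fin N) G.A :=
  fun i j => (List.ofFn fun a => G.u (i a) (j a)).prod

/-- The matrix of `T`, with its scalar entries viewed in `A`. -/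
def scalarMatrix (G : OrthogonalCMQG N) {k l : ℕ} (T : TPow N k →ₗ[ℂ] TPow N l) :
    Matrix (Fin l → Fin N) (Fin k → Fin N) G.A :=
  (LinearMap.toMatrix (tBasis N k) (tBasis N l) T).map (algebraMap ℂ G.A)

/-- The intertwiner spaces `{T | T u^{⊗ k} = u^{⊗ l} T}`. -/
def intertwiners (G : OrthogonalCMQG N) : OperatorSpaces N := fun k l =>
  { carrier := {T | G.scalarMatrix T * G.uPow k = G.uPow l * G.scalarMatrix T}
    add_mem' := by
      intro S T hS hT
      have h : G.scalarMatrix (S + T) = G.scalarMatrix S + G.scalarMatrix T := by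
        ext i j; simp [scalarMatrix]
      simp only [Set.mem_ofPred_eq] at hS hT ⊢
      rw [h, Matrix.add_mul, Matrix.mul_add, hS, hT]
    zero_mem' := by
      have h : G.scalarMatrix (0 : TPow N k →ₗ[ℂ] TPow N l) = 0 := by
        ext i j; simp [scalarMatrix]
      simp [h]
    smul_mem' := by
      intro c T hT
      have h : G.scalarMatrix (c • T) = c • G.scalarMatrix T := by
        ext i j; simp [scalarMatrix, Algebra.smul_def]
      simp only [Set.mem_ofPred_eq] at hT ⊢
      rw [h, Matrix.smul_mul, Matrix.mul_smul, hT] }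

/-- `G` is the easy quantum group `G_N(C)`: its intertwiner spaces are the spans of the `T_p` with
`p ∈ C(k, l)`. -/
def IsEasy (G : OrthogonalCMQG N) (C : PartitionCategory) : Prop :=
  ∀ k l : ℕ, G.intertwiners k l = R N C k l

/-- Two quantum groups of size `N` are considered the same if they have the same intertwiner
spaces. -/
def Same (G₁ : OrthogonalCMQG.{u} N) (G₂ : OrthogonalCMQG.{v} N) : Prop :=
  ∀ k l : ℕ, G₁.intertwiners k l = G₂.intertwiners k l

end OrthogonalCMQG

end EasyQG

end

/-! A non-crossing category is recovered from its operator spaces because, for N ≥ 4, the maps `T_p`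
with `p` non-crossing are linearly independent (`linearIndependent_T`): such a `T_p` lies in the
span over `C` only if `p` is in `C`. The statement on quantum groups follows, since their
intertwiner spaces are these spans.

For independence, read the n = k + l points in cyclic order and use only four of the N labels. The
indicators of the labellings constant on the blocks of `p` then have Gram matrix 4^b(p ∨ q), where b
counts blocks. Doubling every point and tracing the outlines of the blocks turns `p` into a
non-crossing pairing of 2n points, encoded by the permutation `succPerm p` that moves each point to
the cyclically next one of its block. Two superposed pairings form n + 2b(p ∨ q) - b(p) - b(q)
loops, by planarity. Hence 2^n 4^b(p ∨ q) = 2^b(p) 2^b(q) 2^loops (`gramRel`): up to positive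
weights, the Gram matrix is that of the pairings with two labels. The pairings are independent by
triangularity (`coeff_eq_zero_of_succPerm`): a pairing is determined by the left ends of its arcs,
and a two-label colouring records these. A relation among the four-label indicators has norm zero,
so the weighted relation among pairings has norm zero too, and all coefficients vanish. -/

namespace EasyQG

/-! ### Non-crossing partitions of `Fin n` -/

/-- Labellings that are constant on the blocks of `p`. -/
def ConstOn {n : ℕ} {C : Type} (p : Setoid (Fin n)) (x : Fin n → C) : Prop :=
  ∀ i j, p i j → x i = x j

/-- Non-crossing equivalence relations on a finite linear order. -/
def NonCrossing {n : ℕ} (p : Setoid (Fin n)) : Prop :=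
  ∀ a b c d : Fin n, a < b → b < c → c < d → p a c → p b d → p a b

/-- The partition obtained by turning the point `i` into a singleton. -/
def isolate {n : ℕ} (q : Setoid (Fin n)) (i : Fin n) : Setoid (Fin n) where
  r x y := x = y ∨ (x ≠ i ∧ y ≠ i ∧ q x y)
  iseqv :=
    { refl := fun _ => .inl rfl
      symm := by
        rintro x y (h | ⟨h1, h2, h3⟩)
        · exact .inl h.symm
        · exact .inr ⟨h2, h1, q.symm h3⟩
      trans := by
        rintro x y z (rfl | ⟨h1, h2, h3⟩) (rfl | ⟨h4, h5, h6⟩)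
        · exact .inl rfl
        · exact .inr ⟨h4, h5, h6⟩
        · exact .inr ⟨h1, h2, h3⟩
        · exact .inr ⟨h1, h5, q.trans h3 h6⟩ }

/-- The partition obtained by joining the blocks of `a` and `b`. -/
def join {n : ℕ} (q : Setoid (Fin n)) (a b : Fin n) : Setoid (Fin n) where
  r x y := q x y ∨ ((q x a ∨ q x b) ∧ (q y a ∨ q y b))
  iseqv :=
    { refl := fun x => .inl (q.refl x)
      symm := by
        rintro x y (h | ⟨h1, h2⟩)
        · exact .inl (q.symm h)
        · exact .inr ⟨h2, h1⟩
      trans := by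
        rintro x y z (h | ⟨h1, h2⟩) (h' | ⟨h3, h4⟩)
        · exact .inl (q.trans h h')
        · exact .inr ⟨h3.imp (q.trans h) (q.trans h), h4⟩
        · exact .inr ⟨h1, h2.imp (q.trans (q.symm h')) (q.trans (q.symm h'))⟩
        · exact .inr ⟨h1, h4⟩ }

theorem isolate_apply {n : ℕ} (q : Setoid (Fin n)) (i x y : Fin n) :
    isolate q i x y ↔ x = y ∨ (x ≠ i ∧ y ≠ i ∧ q x y) := Iff.rfl

theorem join_apply {n : ℕ} (q : Setoid (Fin n)) (a b x y : Fin n) :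
    join q a b x y ↔ q x y ∨ ((q x a ∨ q x b) ∧ (q y a ∨ q y b)) := Iff.rfl

/-- `y` lies strictly between `x` and `z`. -/
def Btw {n : ℕ} (x z y : Fin n) : Prop := (x < y ∧ y < z) ∨ (z < y ∧ y < x)

theorem NonCrossing.btw_iff {n : ℕ} {p : Setoid (Fin n)} (hp : NonCrossing p) {x z y w : Fin n}
    (hxz : p x z) (hyw : p y w) (hxy : ¬ p x y) : Btw x z y ↔ Btw x z w := by
  have hzx : p z x := p.symm hxz
  have hwy : p w y := p.symm hyw
  have hyx : ¬ p y x := fun h => hxy (p.symm h)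
  have hxw : ¬ p x w := fun h => hxy (p.trans h hwy)
  have hwx : ¬ p w x := fun h => hxw (p.symm h)
  have hzy : ¬ p z y := fun h => hxy (p.trans hxz h)
  have hyz : ¬ p y z := fun h => hzy (p.symm h)
  have hzw : ¬ p z w := fun h => hxw (p.trans hxz h)
  have hwz : ¬ p w z := fun h => hzw (p.symm h)
  have h1 : x ≠ y := fun h => hxy (h ▸ p.refl x)
  have h2 : x ≠ w := fun h => hxw (h ▸ p.refl x)
  have h3 : z ≠ y := fun h => hzy (h ▸ p.refl z)
  have h4 : z ≠ w := fun h => hzw (h ▸ p.refl z)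
  -- These are the eight orders in which the pairs {x, z} and {y, w} alternate.
  have c1 := hp x y z w
  have c2 := hp x w z y
  have c3 := hp z y x w
  have c4 := hp z w x y
  have c5 := hp y x w z
  have c6 := hp y z w x
  have c7 := hp w x y z
  have c8 := hp w z y x
  unfold Btw
  grind

theorem nonCrossing_of_btw {n : ℕ} {p : Setoid (Fin n)}
    (h : ∀ x z y w, p x z → p y w → ¬ p x y → (Btw x z y ↔ Btw x z w)) : NonCrossing p := by
  intro a b c d hab hbc hcd hac hbd
  by_contra hn
  have := (h a c b d hac hbd hn).1 (.inl ⟨hab, hbc⟩)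
  unfold Btw at this
  omega

theorem btw_swap {n : ℕ} {x z y w : Fin n} (h1 : x ≠ y) (h2 : x ≠ w) (h3 : z ≠ y) (h4 : z ≠ w) :
    (Btw x z y ↔ Btw x z w) ↔ (Btw y w x ↔ Btw y w z) := by
  unfold Btw
  grind

theorem NonCrossing.isolate {n : ℕ} {q : Setoid (Fin n)} (hq : NonCrossing q) (i : Fin n) :
    NonCrossing (isolate q i) := by
  intro a b c d hab hbc hcd hac hbd
  rw [isolate_apply] at *
  have := hq a b c d hab hbc hcd
  grind

/-- Only singletons lie strictly between `a` and `b`, so no pair from a third block separates `a`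
from `b`; the two blocks lie on the same side of every such pair. -/
theorem NonCrossing.join {n : ℕ} {q : Setoid (Fin n)} (hq : NonCrossing q) {a b : Fin n}
    (hs : ∀ c, a < c → c < b → ∀ d, q c d → c = d) (hab : a < b) : NonCrossing (join q a b) := by
  have key : ∀ x z y w, q x a → q z b → q y w → ¬ q y a → ¬ q y b →
      (Btw y w x ↔ Btw y w z) := by
    intro x z y w hx hz hyw hya hyb
    have e1 := hq.btw_iff hyw (q.symm hx) hya
    have e2 := hq.btw_iff hyw (q.symm hz) hyb
    rw [← e1, ← e2]
    have hwa : ¬ q w a := fun h => hya (q.trans hyw h)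
    have hwb : ¬ q w b := fun h => hyb (q.trans hyw h)
    have n1 : y ≠ a := fun h => hya (h ▸ q.refl y)
    have n2 : y ≠ b := fun h => hyb (h ▸ q.refl y)
    have n3 : w ≠ a := fun h => hwa (h ▸ q.refl w)
    have n4 : w ≠ b := fun h => hwb (h ▸ q.refl w)
    have s1 := fun h1 h2 => hs y h1 h2 w hyw
    have s2 := fun h1 h2 => hs w h1 h2 y (q.symm hyw)
    unfold Btw
    grind
  have key2 : ∀ x z y w, (q x a ∨ q x b) → (q z a ∨ q z b) → q y w → ¬ (q y a ∨ q y b) →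
      (Btw y w x ↔ Btw y w z) := by
    intro x z y w hx hz hyw hy
    push Not at hy
    rcases hx with hx | hx <;> rcases hz with hz | hz
    · exact hq.btw_iff hyw (q.trans hx (q.symm hz)) fun h => hy.1 (q.trans h hx)
    · exact key x z y w hx hz hyw hy.1 hy.2
    · exact (key z x y w hz hx hyw hy.1 hy.2).symm
    · exact hq.btw_iff hyw (q.trans hx (q.symm hz)) fun h => hy.2 (q.trans h hx)
  refine nonCrossing_of_btw ?_
  intro x z y w hxz hyw hxy
  rw [join_apply] at *
  push Not at hxy
  rcases hxz with hxz | ⟨hx, hz⟩ <;> rcases hyw with hyw | ⟨hy, hw⟩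
  · exact hq.btw_iff hxz hyw hxy.1
  · exact key2 y w x z hy hw hxz fun h => hxy.2 h |>.elim fun h1 h2 => hy.elim h1 h2
  · have hy : ¬ (q y a ∨ q y b) := fun h => (hxy.2 hx).elim fun h1 h2 => h.elim h1 h2
    have hne : ∀ {s t}, (q s a ∨ q s b) → ¬ (q t a ∨ q t b) → s ≠ t := by
      rintro s t hs ht rfl
      exact ht hs
    have hw : ¬ (q w a ∨ q w b) := fun h => hy (h.imp (q.trans hyw) (q.trans hyw))
    rw [btw_swap (hne hx hy) (hne hx hw) (hne hz hy) (hne hz hw)]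
    exact key2 x z y w hx hz hyw hy
  · exact ((hxy.2 hx).elim fun h1 h2 => hy.elim h1 h2).elim

/-- A non-crossing partition is determined by the first and the last points of its blocks. -/
theorem NonCrossing.eq_of_first_last {n : ℕ} {p q : Setoid (Fin n)}
    (hp : NonCrossing p) (hq : NonCrossing q)
    (hmin : ∀ j, (∃ i, i < j ∧ p i j) ↔ ∃ i, i < j ∧ q i j)
    (hmax : ∀ i, (∃ j, i < j ∧ p i j) ↔ ∃ j, i < j ∧ q i j) : p = q := by
  have key : ∀ d : ℕ, ∀ i j : Fin n, i < j → (j : ℕ) - i = d → (p i j ↔ q i j) := by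
    intro d
    induction d using Nat.strong_induction_on with
    | _ d ih =>
      have step : ∀ {p q : Setoid (Fin n)}, NonCrossing q →
          (∀ j, (∃ i, i < j ∧ p i j) → ∃ i, i < j ∧ q i j) →
          (∀ i, (∃ j, i < j ∧ p i j) → ∃ j, i < j ∧ q i j) →
          (∀ i j : Fin n, i < j → (j : ℕ) - i < d → (p i j ↔ q i j)) →
          ∀ i j : Fin n, i < j → (j : ℕ) - i = d → p i j → q i j := by
        intro p q hq hmin hmax ih i j hij hd hpij
        -- An intermediate point of the block splits the pair into two closer ones. Otherwise `i`
        -- and `j` are neighbours in their block of `p`.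
        by_cases hk : ∃ k, i < k ∧ k < j ∧ p i k
        · obtain ⟨k, h1, h2, h3⟩ := hk
          exact q.trans ((ih i k h1 (by omega)).1 h3)
            ((ih k j h2 (by omega)).1 (p.trans (p.symm h3) hpij))
        · push Not at hk
          obtain ⟨i', hi', hqi⟩ := hmax i ⟨j, hij, hpij⟩
          obtain ⟨j', hj', hqj⟩ := hmin j ⟨i, hij, hpij⟩
          have h1 : j ≤ i' := by
            by_contra hlt
            exact hk i' hi' (not_le.1 hlt) ((ih i i' hi' (by omega)).2 hqi)
          have h2 : j' ≤ i := by
            by_contra hlt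
            exact hk j' (not_le.1 hlt) hj'
              (p.trans hpij (p.symm ((ih j' j hj' (by omega)).2 hqj)))
          rcases h1.eq_or_lt with rfl | h1
          · exact hqi
          rcases h2.eq_or_lt with rfl | h2
          · exact hqj
          -- Here j' < i < j < i', so the connections j'–j and i–i' in `q` alternate and must belong
          -- to one block.
          exact q.trans (q.symm (hq j' i j i' h2 hij h1 hqj hqi)) hqj
      intro i j hij hd
      exact ⟨step hq (fun j => (hmin j).1) (fun j => (hmax j).1)
          (fun i j h h' => ih _ h' i j h rfl) i j hij hd,
        step hp (fun j => (hmin j).2) (fun j => (hmax j).2)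
          (fun i j h h' => (ih _ h' i j h rfl).symm) i j hij hd⟩
  ext i j
  rcases lt_trichotomy i j with h | rfl | h
  · exact key _ i j h rfl
  · exact ⟨fun _ => q.refl i, fun _ => p.refl i⟩
  · exact ⟨fun h' => q.symm ((key _ j i h rfl).1 (p.symm h')),
      fun h' => p.symm ((key _ j i h rfl).2 (q.symm h'))⟩

/-! ### The cyclic successor in a block -/

/-- The number of steps, between `1` and `n`, that lead cyclically from `x` to `y`. -/
def cdist {n : ℕ} (x y : Fin n) : ℕ := if x < y then y - x else y + n - x

theorem cdist_inj {n : ℕ} {x y z : Fin n} (h : cdist x y = cdist x z) : y = z := by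
  unfold cdist at h
  ext
  split_ifs at h <;> omega

/-- `π` maps each point to the cyclically next one in its block. -/
def IsSucc {n : ℕ} (p : Setoid (Fin n)) (π : Equiv.Perm (Fin n)) : Prop :=
  ∀ x, p x (π x) ∧ ∀ y, p x y → cdist x (π x) ≤ cdist x y

theorem IsSucc.unique {n : ℕ} {p : Setoid (Fin n)} {π σ : Equiv.Perm (Fin n)}
    (h : IsSucc p π) (h' : IsSucc p σ) : π = σ := by
  ext1 x
  exact cdist_inj (le_antisymm ((h x).2 _ (h' x).1) ((h' x).2 _ (h x).1))

/-- The distance `cdist x x` is n, the largest possible, so a point is its own successor only when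
it is alone in its block. A common successor of x ≠ y would lie both in the cyclic interval from x
to y and in the disjoint one from y to x. -/
theorem exists_isSucc {n : ℕ} (p : Setoid (Fin n)) : ∃ π, IsSucc p π := by
  have h : ∀ x, ∃ y, p x y ∧ ∀ z, p x z → cdist x y ≤ cdist x z := by
    intro x
    obtain ⟨y, hy, hmin⟩ := Set.exists_min_image {y | p x y} (cdist x) (Set.toFinite _)
      ⟨x, p.refl x⟩
    exact ⟨y, hy, hmin⟩
  choose f hf using h
  have inj : Function.Injective f := by
    intro x y hxy
    by_contra hne
    have h1 := (hf x).1
    have h2 := (hf y).1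
    rw [← hxy] at h2
    have hpxy := p.trans h1 (p.symm h2)
    have h3 := (hf x).2 y hpxy
    have h4 := (hf y).2 x (p.symm hpxy)
    rw [← hxy] at h4
    unfold cdist at h3 h4
    split_ifs at h3 h4 <;> omega
  exact ⟨Equiv.ofBijective f (Finite.injective_iff_bijective.1 inj), hf⟩

/-- The cyclic successor permutation of a partition. -/
noncomputable def succPerm {n : ℕ} (p : Setoid (Fin n)) : Equiv.Perm (Fin n) :=
  (exists_isSucc p).choose

theorem succPerm_spec {n : ℕ} (p : Setoid (Fin n)) : IsSucc p (succPerm p) :=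
  (exists_isSucc p).choose_spec

theorem IsSucc.eq_succPerm {n : ℕ} {p : Setoid (Fin n)} {π : Equiv.Perm (Fin n)}
    (h : IsSucc p π) : succPerm p = π :=
  (succPerm_spec p).unique h

/-- The transposition cuts `i` out of its cycle: the predecessor of `i` now goes to the successor of
`i`, and `i` is fixed. -/
theorem succPerm_isolate {n : ℕ} (q : Setoid (Fin n)) (i : Fin n) :
    succPerm (isolate q i) = Equiv.swap i (succPerm q i) * succPerm q := by
  refine IsSucc.eq_succPerm ?_
  have hπ := succPerm_spec q
  set π := succPerm q
  intro x
  simp only [Equiv.Perm.mul_apply, isolate_apply]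
  by_cases hx : x = i
  · subst hx
    simp only [Equiv.swap_apply_right, true_or, true_and]
    rintro y (rfl | ⟨h, -⟩)
    · rfl
    · exact absurd rfl h
  by_cases hxi : π x = i
  · rw [hxi, Equiv.swap_apply_left]
    have hqxi : q x i := hxi ▸ (hπ x).1
    have hne : π i ≠ i := fun h => hx (π.injective (hxi.trans h.symm))
    refine ⟨.inr ⟨hx, hne, q.trans hqxi (hπ i).1⟩, ?_⟩
    have hy : ∀ y, y ≠ i → q x y → cdist x (π i) ≤ cdist x y := by
      intro y hyi hxy
      have h1 := (hπ x).2 y hxy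
      have h2 := (hπ i).2 y (q.trans (q.symm hqxi) hxy)
      have h3 := (hπ i).2 x (q.symm hqxi)
      rw [hxi] at h1
      unfold cdist at *
      split_ifs at * <;> omega
    rintro y (rfl | ⟨-, h1, h2⟩)
    · exact hy _ hx (q.refl _)
    · exact hy y h1 h2
  · rw [Equiv.swap_apply_of_ne_of_ne hxi fun h => hx (π.injective h)]
    refine ⟨.inr ⟨hx, hxi, (hπ x).1⟩, ?_⟩
    rintro y (rfl | ⟨-, -, h2⟩)
    · exact (hπ _).2 _ (q.refl _)
    · exact (hπ x).2 y h2

/-- The transposition merges two cycles: `a` goes to `b`, and the predecessor of `b` goes to the old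
successor of `a`. This is the cyclic order of the joined block because none of its points lies
between `a` and `b`, and non-crossing puts each of the two blocks into a single gap of the other. -/
theorem succPerm_join {n : ℕ} {q : Setoid (Fin n)} (hq : NonCrossing q) {a b : Fin n}
    (hab : a < b) (hnab : ¬ q a b) (hs : ∀ c, a < c → c < b → ∀ d, q c d → c = d) :
    succPerm (join q a b) = Equiv.swap (succPerm q a) b * succPerm q := by
  refine IsSucc.eq_succPerm ?_
  have hπ := succPerm_spec q
  set π := succPerm q
  have hba : ¬ q b a := fun h => hnab (q.symm h)
  have gap : ∀ y, (q y a ∨ q y b) → y ≤ a ∨ b ≤ y := by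
    intro y hy
    by_contra hc
    push Not at hc
    rcases hy with hy | hy
    · exact absurd (hs y hc.1 hc.2 a hy) hc.1.ne'
    · exact absurd (hs y hc.1 hc.2 b hy) hc.2.ne
  intro x
  simp only [Equiv.Perm.mul_apply, join_apply]
  by_cases hxa : x = a
  · subst hxa
    rw [Equiv.swap_apply_left]
    refine ⟨.inr ⟨.inl (q.refl _), .inr (q.refl _)⟩, ?_⟩
    intro y hy
    have hy' : q y x ∨ q y b := hy.elim (fun h => .inl (q.symm h)) fun h => h.2
    have := gap y hy'
    unfold cdist
    split_ifs <;> omega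
  by_cases hxb : π x = b
  · rw [hxb, Equiv.swap_apply_right]
    have hqxb : q x b := hxb ▸ (hπ x).1
    refine ⟨.inr ⟨.inr hqxb, .inl (q.symm (hπ a).1)⟩, ?_⟩
    have hqxa : ¬ q x a := fun h => hnab (q.trans (q.symm h) hqxb)
    have gx := gap x (.inr hqxb)
    have gpa := gap (π a) (.inl (q.symm (hπ a).1))
    have hAll : ∀ z, q a z → (Btw x b z ↔ Btw x b a) := fun z hz =>
      (hq.btw_iff hqxb hz hqxa).symm
    have hneq : ∀ z, q a z → z ≠ x ∧ z ≠ b := fun z hz =>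
      ⟨fun h => hqxa (q.symm (h ▸ hz)), fun h => hnab (h ▸ hz)⟩
    have e1 := hAll _ (hπ a).1
    have e2 := hneq _ (hπ a).1
    intro y hy
    have hy' : q y a ∨ q y b := hy.elim (fun h => .inr (q.trans (q.symm h) hqxb)) fun h => h.2
    have gy := gap y hy'
    have h5 := (hπ a).2 a (q.refl a)
    have e0 := hneq _ (q.refl a)
    rcases hy' with hy' | hy'
    · have e3 := hAll y (q.symm hy')
      have e4 := hneq y (q.symm hy')
      have h2 := (hπ a).2 y (q.symm hy')
      unfold Btw at e1 e3
      unfold cdist at *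
      split_ifs at * <;> omega
    · have h1 := (hπ x).2 y (q.trans hqxb (q.symm hy'))
      rw [hxb] at h1
      have h2 := (hπ a).2 a (q.refl a)
      unfold Btw at e1
      unfold cdist at *
      split_ifs at * <;> omega
  · rw [Equiv.swap_apply_of_ne_of_ne (fun h => hxa (π.injective h)) hxb]
    refine ⟨.inl (hπ x).1, ?_⟩
    -- The other block sits in the gap that starts at `a`, respectively ends at `b`, and `x` is not
    -- the point where this gap starts.
    have main : ∀ y, ¬ q x y → (q x a ∨ q x b) → (q y a ∨ q y b) →
        cdist x (π x) ≤ cdist x y := by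
      intro y hnxy hx hy
      have gx := gap x hx
      have gy := gap y hy
      have gp := gap (π x) (hx.imp (q.trans (q.symm (hπ x).1)) (q.trans (q.symm (hπ x).1)))
      have hnx : y ≠ x := fun h => hnxy (h ▸ q.refl _)
      have hnp : y ≠ π x := fun h => hnxy (h ▸ (hπ x).1)
      rcases hx with hx | hx
      · have hyb : q y b := hy.resolve_left fun h => hnxy (q.trans hx (q.symm h))
        have e1 := hq.btw_iff (hπ x).1 hyb hnxy
        have h1 := (hπ x).2 a hx
        have hnb : x ≠ b := fun h => hba (h ▸ hx)
        unfold Btw at e1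
        unfold cdist at *
        split_ifs at * <;> omega
      · have hya : q y a := hy.resolve_right fun h => hnxy (q.trans hx (q.symm h))
        have e1 := hq.btw_iff (hπ x).1 hya hnxy
        have h1 := (hπ x).2 b hx
        have hpa : π x ≠ a := fun h => hba (q.trans (q.symm hx) (h ▸ (hπ x).1))
        unfold Btw at e1
        unfold cdist at *
        split_ifs at * <;> omega
    intro y hy
    by_cases hxy : q x y
    · exact (hπ x).2 y hxy
    · have := hy.resolve_left hxy
      exact main y hxy this.1 this.2

/-! ### Counting labellings -/

/-- Translation along `B` moves `x i` and keeps `x k`, so the difference `x i - x k` is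
equidistributed over `C`; the last factor counts its zero fibre. -/
theorem card_shift {n : ℕ} {C : Type} [AddCommGroup C] (P : (Fin n → C) → Prop)
    (B : Set (Fin n)) {i k : Fin n} (hi : i ∈ B) (hk : k ∉ B)
    (h : ∀ x v, P x → P (x + B.indicator fun _ => v)) :
    Nat.card {x // P x} = Nat.card C * Nat.card {x // P x ∧ x i = x k} := by
  rw [← Nat.card_prod]
  refine Nat.card_congr
    { toFun := fun x => (x.1 i - x.1 k,
        ⟨x.1 + B.indicator fun _ => -(x.1 i - x.1 k), h _ _ x.2, by simp [hi, hk]⟩)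
      invFun := fun y => ⟨y.2.1 + B.indicator fun _ => y.1, h _ _ y.2.2.1⟩
      left_inv := ?_
      right_inv := ?_ }
  · intro x
    ext j
    by_cases hj : j ∈ B
    · simp only [Pi.add_apply, Set.indicator_of_mem hj]
      abel
    · simp [hj]
  · rintro ⟨v, y, hy, hik⟩
    have hv : (y + B.indicator fun _ => v) i - (y + B.indicator fun _ => v) k = v := by
      simp [hi, hk, hik]
    refine Prod.ext hv (Subtype.ext ?_)
    simp only [hv]
    ext j
    by_cases hj : j ∈ B <;> simp [hj]

/-- The number of labellings by `c` labels that are constant on the blocks of `p` and of `q`. -/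
noncomputable def constCard {n : ℕ} (c : ℕ) (p q : Setoid (Fin n)) : ℕ :=
  Nat.card {x : Fin n → Fin c // ConstOn p x ∧ ConstOn q x}

/-- The number of labellings by two labels that are constant on the blocks of `p`. -/
noncomputable def blockWeight {n : ℕ} (p : Setoid (Fin n)) : ℕ :=
  Nat.card {x : Fin n → Fin 2 // ConstOn p x}

/-- The labellings that two maps pull back to the same labelling. -/
def Agree {n : ℕ} {C : Type} (π σ : Equiv.Perm (Fin n)) (x : Fin n → C) : Prop :=
  ∀ j, x (π j) = x (σ j)

/-- The number of labellings by two labels with the same pullback under both successor maps. -/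
noncomputable def agreeCard {n : ℕ} (p q : Setoid (Fin n)) : ℕ :=
  Nat.card {x : Fin n → Fin 2 // Agree (succPerm p) (succPerm q) x}

/-- The point `i` is a block of `p`. -/
def IsSing {n : ℕ} (p : Setoid (Fin n)) (i : Fin n) : Prop := ∀ d, p i d → i = d

theorem isolate_eq_self {n : ℕ} {p : Setoid (Fin n)} {i : Fin n} (h : IsSing p i) :
    isolate p i = p := by
  ext x y
  rw [isolate_apply]
  constructor
  · rintro (rfl | h)
    · exact p.refl _
    · exact h.2.2
  · intro hxy
    by_cases e : x = y
    · exact .inl e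
    · refine .inr ⟨?_, ?_, hxy⟩
      · rintro rfl
        exact e (h _ hxy)
      · rintro rfl
        exact e (h _ (p.symm hxy)).symm

theorem isSing_isolate_self {n : ℕ} (p : Setoid (Fin n)) (i : Fin n) :
    IsSing (isolate p i) i := by
  rintro d (h | h)
  · exact h
  · exact absurd rfl h.1

theorem IsSing.isolate {n : ℕ} {p : Setoid (Fin n)} {j : Fin n} (h : IsSing p j) (i : Fin n) :
    IsSing (isolate p i) j := by
  rintro d (h' | h')
  · exact h'
  · exact h d h'.2.2

theorem IsSing.join {n : ℕ} {p : Setoid (Fin n)} {j a b : Fin n} (h : IsSing p j)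
    (ha : j ≠ a) (hb : j ≠ b) : IsSing (join p a b) j := by
  rintro d (h' | h')
  · exact h d h'
  · exact (h'.1.elim (fun e => ha (h _ e)) fun e => hb (h _ e)).elim

theorem IsSing.succPerm_eq {n : ℕ} {p : Setoid (Fin n)} {i : Fin n} (h : IsSing p i) :
    succPerm p i = i := (h _ (succPerm_spec p i).1).symm

/-! ### Effect of isolating a point and joining blocks on the counts -/

theorem ConstOn.shift_isolate {n : ℕ} {C : Type} [AddCommGroup C] {q : Setoid (Fin n)} {i : Fin n}
    {x : Fin n → C} (h : ConstOn (isolate q i) x) (v : C) :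
    ConstOn (isolate q i) (x + ({i} : Set (Fin n)).indicator fun _ => v) := by
  intro a b hab
  have := h a b hab
  rcases hab with rfl | ⟨h1, h2, -⟩
  · rfl
  · simp [h1, h2, this]

theorem constOn_iff_isolate {n : ℕ} {C : Type} {q : Setoid (Fin n)} {i k : Fin n} (hik : q i k)
    (hne : k ≠ i) (x : Fin n → C) : ConstOn q x ↔ ConstOn (isolate q i) x ∧ x i = x k := by
  constructor
  · intro h
    refine ⟨?_, h i k hik⟩
    rintro a b (rfl | h')
    · rfl
    · exact h a b h'.2.2
  · rintro ⟨h, hx⟩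
    have main : ∀ b, b ≠ i → q i b → x i = x b := fun b hb hib =>
      hx.trans (h k b (.inr ⟨hne, hb, q.trans (q.symm hik) hib⟩))
    intro a b hab
    by_cases ha : a = i <;> by_cases hb : b = i
    · rw [ha, hb]
    · subst ha
      exact main b hb hab
    · subst hb
      exact (main a ha (q.symm hab)).symm
    · exact h a b (.inr ⟨ha, hb, hab⟩)

theorem constCard_isolate {n : ℕ} (c : ℕ) [NeZero c] {p q : Setoid (Fin n)} {i k : Fin n}
    (hik : q i k) (hne : k ≠ i) :
    constCard c (isolate p i) (isolate q i) = c * constCard c (isolate p i) q := by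
  unfold constCard
  rw [card_shift (fun x => ConstOn (isolate p i) x ∧ ConstOn (isolate q i) x) {i}
    (Set.mem_singleton i) (k := k) (by simpa using hne)
    fun x v h => ⟨h.1.shift_isolate v, h.2.shift_isolate v⟩, Nat.card_fin]
  simp only [constOn_iff_isolate hik hne, and_assoc]

theorem constCard_isolate_isolate {n : ℕ} (c : ℕ) [NeZero c] {p q : Setoid (Fin n)} {i k : Fin n}
    (hp : p i k) (hq : q i k) (hne : k ≠ i) :
    constCard c (isolate p i) (isolate q i) = c * constCard c p q := by
  rw [constCard_isolate c hq hne]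
  unfold constCard
  refine congrArg _ (Nat.card_congr (Equiv.subtypeEquivRight fun x => ?_))
  simp only [constOn_iff_isolate hq hne, constOn_iff_isolate hp hne]
  tauto

theorem constCard_self {n : ℕ} (p : Setoid (Fin n)) : constCard 2 p p = blockWeight p := by
  simp only [constCard, blockWeight, and_self]

theorem blockWeight_isolate {n : ℕ} {q : Setoid (Fin n)} {i k : Fin n}
    (hik : q i k) (hne : k ≠ i) : blockWeight (isolate q i) = 2 * blockWeight q := by
  rw [← constCard_self, ← constCard_self, constCard_isolate_isolate 2 hik hik hne]

theorem constOn_join {n : ℕ} {C : Type} {q : Setoid (Fin n)} {a b : Fin n} (x : Fin n → C) :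
    ConstOn (join q a b) x ↔ ConstOn q x ∧ x b = x a := by
  constructor
  · exact fun h => ⟨fun i j hij => h i j (.inl hij),
      h b a (.inr ⟨.inr (q.refl _), .inl (q.refl _)⟩)⟩
  · rintro ⟨h, hx⟩ i j (hij | ⟨hi, hj⟩)
    · exact h i j hij
    · have main : ∀ i, (q i a ∨ q i b) → x i = x a := by
        rintro i (hi | hi)
        · exact h _ _ hi
        · exact (h _ _ hi).trans hx
      rw [main i hi, main j hj]

theorem blockWeight_join {n : ℕ} {q : Setoid (Fin n)} {a b : Fin n} (hab : ¬ q a b) :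
    blockWeight q = 2 * blockWeight (join q a b) := by
  unfold blockWeight
  rw [card_shift (fun x : Fin n → Fin 2 => ConstOn q x) {j | q j b} (i := b) (k := a) (q.refl b)
    hab, Nat.card_fin]
  · simp only [constOn_join]
  · intro x v h i j hij
    have : q i b ↔ q j b := ⟨q.trans (q.symm hij), q.trans hij⟩
    have hx := h i j hij
    by_cases hj : q j b <;> simp [this, hj, hx]

theorem Agree.shift {n : ℕ} {C : Type} [AddCommGroup C] {π σ : Equiv.Perm (Fin n)}
    {x : Fin n → C} (h : Agree π σ x) {i j : Fin n} (hπ : π j = i) (hσ : σ j = i) (v : C) :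
    Agree π σ (x + ({i} : Set (Fin n)).indicator fun _ => v) := by
  intro l
  by_cases hl : l = j
  · rw [hl, hπ, hσ]
  · have h1 : π l ≠ i := fun e => hl (π.injective (e.trans hπ.symm))
    have h2 : σ l ≠ i := fun e => hl (σ.injective (e.trans hσ.symm))
    simp [h1, h2, h l]

theorem agree_swap_mul {n : ℕ} {C : Type} {π σ : Equiv.Perm (Fin n)} {x : Fin n → C} {i k : Fin n}
    (h : x i = x k) : Agree π (Equiv.swap i k * σ) x ↔ Agree π σ x := by
  have hs : ∀ j, x (Equiv.swap i k j) = x j := by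
    intro j
    rcases eq_or_ne j i with rfl | h1
    · rw [Equiv.swap_apply_left, h]
    rcases eq_or_ne j k with rfl | h2
    · rw [Equiv.swap_apply_right, h]
    rw [Equiv.swap_apply_of_ne_of_ne h1 h2]
  simp only [Agree, Equiv.Perm.mul_apply, hs]

/-- Both maps take the value `i` at `j` and nowhere else, so `x i` is free. Once `x i = x k` is
imposed the transposition is invisible, and agreement of `π` and `σ` at `l` forces this very
equation. -/
theorem card_agree_swap_mul {n : ℕ} {π σ : Equiv.Perm (Fin n)} {i k j l : Fin n} (hne : k ≠ i)
    (hπ : π j = i) (hσ : (Equiv.swap i k * σ) j = i)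
    (hl : ∀ x : Fin n → Fin 2, x (π l) = x (σ l) → x i = x k) :
    Nat.card {x : Fin n → Fin 2 // Agree π (Equiv.swap i k * σ) x}
      = 2 * Nat.card {x : Fin n → Fin 2 // Agree π σ x} := by
  rw [card_shift (fun x : Fin n → Fin 2 => Agree π (Equiv.swap i k * σ) x) {i}
    (Set.mem_singleton i) (k := k) (by simpa using hne) fun x v h => h.shift hπ hσ v, Nat.card_fin]
  congr 2
  congr 1
  ext x
  exact ⟨fun h => (agree_swap_mul h.2).1 h.1, fun h => ⟨(agree_swap_mul (hl x (h l))).2 h,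
    hl x (h l)⟩⟩

theorem agreeCard_isolate {n : ℕ} {p q : Setoid (Fin n)} {i : Fin n} (hp : IsSing p i)
    (hq : ¬ IsSing q i) : agreeCard p (isolate q i) = 2 * agreeCard p q := by
  unfold agreeCard
  rw [succPerm_isolate]
  have hne : succPerm q i ≠ i := by
    intro h
    refine hq fun d hd => ?_
    have h1 := (succPerm_spec q i).2 d hd
    rw [h] at h1
    unfold cdist at h1
    split_ifs at h1 <;> omega
  refine card_agree_swap_mul (j := i) (l := i) hne hp.succPerm_eq (by simp) fun x h => ?_
  rwa [hp.succPerm_eq] at h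

theorem agreeCard_join {n : ℕ} {p q : Setoid (Fin n)} (hq : NonCrossing q) {a b : Fin n}
    (hab : a < b) (hnab : ¬ q a b) (hs : ∀ c, a < c → c < b → IsSing q c)
    (hp : succPerm p a = b) : agreeCard p (join q a b) = 2 * agreeCard p q := by
  unfold agreeCard
  rw [succPerm_join hq hab hnab hs, Equiv.swap_comm]
  have hne : succPerm q a ≠ b := fun h => hnab (h ▸ (succPerm_spec q a).1)
  refine card_agree_swap_mul (j := a) (l := a) hne hp (by simp) fun x h => ?_
  rwa [hp] at h

/-- The condition at `a` is vacuous before `b` is cut out; afterwards `a` inherits the former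
condition at `b`, and the one at `b` is vacuous. -/
theorem agreeCard_isolate_isolate {n : ℕ} {p q : Setoid (Fin n)} {a b : Fin n}
    (hp : succPerm p a = b) (hq : succPerm q a = b) :
    agreeCard (isolate p b) (isolate q b) = agreeCard p q := by
  unfold agreeCard
  rw [succPerm_isolate, succPerm_isolate]
  congr 2
  ext x
  have hother : ∀ p : Setoid (Fin n), succPerm p a = b → ∀ j, j ≠ a → j ≠ b →
      (Equiv.swap b (succPerm p b) * succPerm p) j = succPerm p j := by
    intro p hp j ha hb
    rw [Equiv.Perm.mul_apply, Equiv.swap_apply_of_ne_of_ne]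
    · exact fun h => ha ((succPerm p).injective (h.trans hp.symm))
    · exact fun h => hb ((succPerm p).injective h)
  have hpa : (Equiv.swap b (succPerm p b) * succPerm p) a = succPerm p b := by simp [hp]
  have hqa : (Equiv.swap b (succPerm q b) * succPerm q) a = succPerm q b := by simp [hq]
  constructor
  · intro h j
    by_cases ha : j = a
    · rw [ha, hp, hq]
    by_cases hb : j = b
    · have := h a
      rwa [hpa, hqa, ← hb] at this
    · have := h j
      rwa [hother p hp j ha hb, hother q hq j ha hb] at this
  · intro h j
    by_cases ha : j = a
    · rw [ha, hpa, hqa, h b]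
    by_cases hb : j = b
    · simp [hb]
    · rw [hother p hp j ha hb, hother q hq j ha hb, h j]

/-! ### Comparison of the two Gram matrices -/

/-- Take a connected pair at minimal distance. A non-singleton between its points would, by
non-crossing, have its partner there too, and this pair would be closer. -/
theorem exists_closest_pair {n : ℕ} {p : Setoid (Fin n)} (hp : NonCrossing p)
    (h : ∃ i, ¬ IsSing p i) : ∃ a b, a < b ∧ p a b ∧ succPerm p a = b ∧
      ∀ c, a < c → c < b → IsSing p c := by
  have hne : {ab : Fin n × Fin n | ab.1 < ab.2 ∧ p ab.1 ab.2}.Nonempty := by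
    obtain ⟨i, hi⟩ := h
    unfold IsSing at hi
    push Not at hi
    obtain ⟨d, hd, hid⟩ := hi
    rcases hid.lt_or_gt with h | h
    · exact ⟨(i, d), h, hd⟩
    · exact ⟨(d, i), h, p.symm hd⟩
  obtain ⟨⟨a, b⟩, ⟨hab, hpab⟩, hmin⟩ := Set.exists_min_image _
    (fun ab : Fin n × Fin n => (ab.2 : ℕ) - ab.1) (Set.toFinite _) hne
  have hmin' : ∀ c d : Fin n, c < d → p c d → (b : ℕ) - a ≤ d - c :=
    fun c d h1 h2 => hmin (c, d) ⟨h1, h2⟩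
  simp only at hab hpab
  refine ⟨a, b, hab, hpab, ?_, ?_⟩
  · have h1 := (succPerm_spec p a).1
    have h2 := (succPerm_spec p a).2 b hpab
    by_contra hne
    have h3 := hmin' a (succPerm p a)
    unfold cdist at h2
    split_ifs at h2 with h4
    · have := h3 h4 h1
      omega
    · omega
  · intro c hac hcb d hcd
    by_contra hne
    have hca : ¬ p a c := fun h => by
      have := hmin' a c hac h
      omega
    have e := hp.btw_iff hpab hcd hca
    have h5 := hmin' c d
    have h6 := hmin' d c
    have h7 : p d c := p.symm hcd
    unfold Btw at e
    rcases lt_or_gt_of_ne hne with h | h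
    · have := h5 h hcd
      omega
    · have := h6 h h7
      omega

/-- The number of points that are not singletons in both partitions. -/
noncomputable def activeCard {n : ℕ} (p q : Setoid (Fin n)) : ℕ :=
  {i | ¬ (IsSing p i ∧ IsSing q i)}.ncard

theorem activeCard_lt {n : ℕ} {p q p' q' : Setoid (Fin n)} {i : Fin n}
    (h : ∀ j, IsSing p j → IsSing q j → IsSing p' j ∧ IsSing q' j)
    (hi : ¬ (IsSing p i ∧ IsSing q i)) (hi' : IsSing p' i ∧ IsSing q' i) :
    activeCard p' q' < activeCard p q :=
  Set.ncard_lt_ncard ⟨fun j hj hj' => hj (h j hj'.1 hj'.2), fun hsub => hsub hi hi'⟩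
    (Set.toFinite _)

/-- The relation between the entries of the Gram matrices of the labelling indicators with four
labels and of their counterparts in `M₂(ℂ)`. -/
def GramRel {n : ℕ} (p q : Setoid (Fin n)) : Prop :=
  2 ^ n * constCard 4 p q = blockWeight p * blockWeight q * agreeCard p q

theorem GramRel.symm {n : ℕ} {p q : Setoid (Fin n)} (h : GramRel p q) : GramRel q p := by
  have h1 : constCard 4 q p = constCard 4 p q := by
    unfold constCard
    simp only [and_comm]
  have h2 : agreeCard q p = agreeCard p q := by
    unfold agreeCard Agree
    simp only [eq_comm]
  unfold GramRel at *
  rw [h1, h2, h, mul_comm (blockWeight p)]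

theorem gramRel_of_isolate {n : ℕ} {p q : Setoid (Fin n)} {i : Fin n} (hp : IsSing p i)
    (hq : ¬ IsSing q i) (h : GramRel p (isolate q i)) : GramRel p q := by
  have hq' := hq
  unfold IsSing at hq
  push Not at hq
  obtain ⟨k, hik, hne⟩ := hq
  have h1 := constCard_isolate 4 (p := p) hik hne.symm
  rw [isolate_eq_self hp] at h1
  unfold GramRel at *
  rw [h1, blockWeight_isolate hik hne.symm, agreeCard_isolate hp hq'] at h
  linarith

theorem gramRel_of_isolate_isolate {n : ℕ} {p q : Setoid (Fin n)} {a b : Fin n} (hab : a ≠ b)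
    (hp : succPerm p a = b) (hq : succPerm q a = b)
    (h : GramRel (isolate p b) (isolate q b)) : GramRel p q := by
  have hpb : p b a := p.symm (hp ▸ (succPerm_spec p a).1)
  have hqb : q b a := q.symm (hq ▸ (succPerm_spec q a).1)
  unfold GramRel at *
  rw [constCard_isolate_isolate 4 hpb hqb hab, blockWeight_isolate hpb hab,
    blockWeight_isolate hqb hab, agreeCard_isolate_isolate hp hq] at h
  linarith

theorem gramRel_of_join {n : ℕ} {p q : Setoid (Fin n)} (hq : NonCrossing q) {a b : Fin n}
    (hab : a < b) (hpab : p a b) (hnab : ¬ q a b) (hs : ∀ c, a < c → c < b → IsSing q c)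
    (hp : succPerm p a = b) (h : GramRel p (join q a b)) : GramRel p q := by
  have h1 : constCard 4 p (join q a b) = constCard 4 p q := by
    unfold constCard
    congr 2
    ext x
    rw [constOn_join]
    exact ⟨fun h => ⟨h.1, h.2.1⟩, fun h => ⟨h.1, h.2, (h.1 a b hpab).symm⟩⟩
  unfold GramRel at *
  rw [h1, agreeCard_join hq hab hnab hs hp] at h
  rw [h, blockWeight_join hnab]
  ring

theorem gramRel_of_forall_isSing {n : ℕ} {p q : Setoid (Fin n)} (hp : ∀ i, IsSing p i)
    (hq : ∀ i, IsSing q i) : GramRel p q := by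
  have hc : ∀ {C : Type} (p : Setoid (Fin n)), (∀ i, IsSing p i) → ∀ x : Fin n → C,
      ConstOn p x := fun p hp x i j hij => by rw [hp i j hij]
  have h1 : constCard 4 p q = 4 ^ n := by
    unfold constCard
    rw [Nat.card_congr (Equiv.subtypeUnivEquiv fun x => ⟨hc p hp x, hc q hq x⟩)]
    simp
  have h2 : ∀ p : Setoid (Fin n), (∀ i, IsSing p i) → blockWeight p = 2 ^ n := by
    intro p hp
    unfold blockWeight
    rw [Nat.card_congr (Equiv.subtypeUnivEquiv fun x => hc p hp x)]
    simp
  have h3 : agreeCard p q = 2 ^ n := by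
    unfold agreeCard
    have h : ∀ x : Fin n → Fin 2, Agree (succPerm p) (succPerm q) x := fun x j => by
      rw [(hp j).succPerm_eq, (hq j).succPerm_eq]
    rw [Nat.card_congr (Equiv.subtypeUnivEquiv h)]
    simp
  rw [GramRel, h1, h2 p hp, h2 q hq, h3, show 4 = 2 * 2 from rfl, mul_pow, mul_assoc]

/-- Every move multiplies both sides of the relation by the same factor. A singleton of only one
partition is isolated in the other (factor 4). If the singletons coincide, a closest pair `a`, `b`
of `p` encloses only singletons of both; `a` and `b` are joined in `q` if necessary (factor 1), and
then `b` is isolated in both (factor 4). -/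
theorem gramRel {n : ℕ} {p q : Setoid (Fin n)} (hp : NonCrossing p) (hq : NonCrossing q) :
    GramRel p q := by
  induction hm : activeCard p q using Nat.strong_induction_on generalizing p q with
  | _ m ih =>
    subst hm
    by_cases h1 : ∃ i, IsSing p i ∧ ¬ IsSing q i
    · obtain ⟨i, hpi, hqi⟩ := h1
      exact gramRel_of_isolate hpi hqi (ih _ (activeCard_lt (i := i)
        (fun j h h' => ⟨h, h'.isolate i⟩) (fun h => hqi h.2) ⟨hpi, isSing_isolate_self q i⟩)
        hp (hq.isolate i) rfl)
    by_cases h2 : ∃ i, IsSing q i ∧ ¬ IsSing p i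
    · obtain ⟨i, hqi, hpi⟩ := h2
      exact (gramRel_of_isolate hqi hpi (ih _ (activeCard_lt (i := i)
        (fun j h h' => ⟨h.isolate i, h'⟩) (fun h => hpi h.1) ⟨isSing_isolate_self p i, hqi⟩)
        (hp.isolate i) hq rfl).symm).symm
    push Not at h1 h2
    by_cases h3 : ∃ i, ¬ IsSing p i
    · obtain ⟨a, b, hab, hpab, hsucc, hs⟩ := exists_closest_pair hp h3
      have hs' : ∀ c, a < c → c < b → IsSing q c := fun c h h' => h1 c (hs c h h')
      have ha : ¬ IsSing p a := fun h => hab.ne (h _ hpab)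
      have hb : ¬ IsSing p b := fun h => hab.ne' (h _ (p.symm hpab))
      by_cases hqab : q a b
      · have hqs : succPerm q a = b := by
          have h4 := (succPerm_spec q a).1
          have h5 := (succPerm_spec q a).2 b hqab
          by_contra hne
          have h6 : a < succPerm q a ∧ succPerm q a < b := by
            unfold cdist at h5
            split_ifs at h5 <;> omega
          exact h6.1.ne' (hs' _ h6.1 h6.2 _ (q.symm h4))
        exact gramRel_of_isolate_isolate hab.ne hsucc hqs (ih _ (activeCard_lt (i := b)
          (fun j h h' => ⟨h.isolate b, h'.isolate b⟩) (fun h => hb h.1)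
          ⟨isSing_isolate_self p b, isSing_isolate_self q b⟩) (hp.isolate b) (hq.isolate b) rfl)
      · refine gramRel_of_join hq hab hpab hqab hs' hsucc ?_
        have hqs : succPerm (join q a b) a = b := by
          rw [succPerm_join hq hab hqab hs', Equiv.Perm.mul_apply, Equiv.swap_apply_left]
        -- The join does not lower the number of active points; isolating `b` in both partitions
        -- does.
        refine gramRel_of_isolate_isolate hab.ne hsucc hqs (ih _ (activeCard_lt (i := b)
          (fun j h h' => ⟨h.isolate b, IsSing.isolate (h'.join ?_ ?_) b⟩) (fun h => hb h.1)
          ⟨isSing_isolate_self p b, isSing_isolate_self _ b⟩) (hp.isolate b)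
          ((hq.join hs' hab).isolate b) rfl)
        · rintro rfl
          exact ha h
        · rintro rfl
          exact hb h
    · push Not at h3
      exact gramRel_of_forall_isSing h3 fun i => h1 i (h3 i)

/-! ### Linear independence -/

theorem exists_lt_rel_iff {n : ℕ} (p : Setoid (Fin n)) (j : Fin n) :
    (∃ i, i < j ∧ p i j) ↔ ¬ j ≤ (succPerm p).symm j := by
  set k := (succPerm p).symm j with hk
  have hkj : succPerm p k = j := by rw [hk, Equiv.apply_symm_apply]
  have h1 := (succPerm_spec p k).1
  rw [hkj] at h1
  constructor
  · rintro ⟨i, hij, h⟩ hle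
    have h2 := (succPerm_spec p k).2 i (p.trans h1 (p.symm h))
    rw [hkj] at h2
    unfold cdist at h2
    split_ifs at h2 <;> omega
  · exact fun h => ⟨k, not_le.1 h, h1⟩

theorem exists_gt_rel_iff {n : ℕ} (p : Setoid (Fin n)) (i : Fin n) :
    (∃ j, i < j ∧ p i j) ↔ ¬ succPerm p i ≤ i := by
  constructor
  · rintro ⟨j, hij, h⟩ hle
    have h2 := (succPerm_spec p i).2 j h
    unfold cdist at h2
    split_ifs at h2 <;> omega
  · exact fun h => ⟨_, not_le.1 h, (succPerm_spec p i).1⟩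

/-- The sum of the left ends of the arcs that join `2 * i + 1` with `2 * π i`. -/
def leftSum {n : ℕ} (π : Equiv.Perm (Fin n)) : ℕ :=
  ∑ i, if π i ≤ i then 2 * (π i : ℕ) else 2 * i + 1

/-- The labelling that marks the first points of the blocks. -/
def firstLabel {n : ℕ} (π : Equiv.Perm (Fin n)) (j : Fin n) : Fin 2 :=
  if j ≤ π.symm j then 1 else 0

theorem firstLabel_apply {n : ℕ} (π : Equiv.Perm (Fin n)) (i : Fin n) :
    firstLabel π (π i) = if π i ≤ i then 1 else 0 := by
  simp [firstLabel]

/-- Give the doubled point 2j the label of j, and 2i + 1 the label of π i. Then left ends of arcs of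
`π` are the even points labelled 1 and the odd points labelled 0. Arcs of `σ` join an odd to an even
point of equal label, so each contains exactly one left end of `π`, and summing these recovers
`leftSum π`. -/
theorem leftSum_eq {n : ℕ} {π σ : Equiv.Perm (Fin n)}
    (h : ∀ i, firstLabel π (π i) = firstLabel π (σ i)) :
    leftSum π = ∑ i, if firstLabel π (σ i) = 1 then 2 * (σ i : ℕ) else 2 * i + 1 := by
  have split : ∀ τ : Equiv.Perm (Fin n),
      (∑ i, if firstLabel π (τ i) = 1 then 2 * (τ i : ℕ) else 2 * (i : ℕ) + 1)
        = (∑ j, if firstLabel π j = 1 then 2 * (j : ℕ) else 0)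
          + ∑ i, if firstLabel π (τ i) = 1 then 0 else 2 * (i : ℕ) + 1 := by
    intro τ
    rw [← Equiv.sum_comp τ fun j => if firstLabel π j = 1 then 2 * (j : ℕ) else 0,
      ← Finset.sum_add_distrib]
    refine Finset.sum_congr rfl fun i _ => ?_
    split_ifs <;> simp
  have h1 : leftSum π = ∑ i, if firstLabel π (π i) = 1 then 2 * (π i : ℕ) else 2 * i + 1 := by
    refine Finset.sum_congr rfl fun i _ => ?_
    rw [firstLabel_apply]
    split_ifs <;> simp_all
  rw [h1, split π, split σ]
  simp only [h]

/-- Each arc of `σ` contributes its smaller end to `leftSum σ`, but its end that is a left end for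
`π` to `leftSum π`. Equal sums force these ends to coincide on every arc. -/
theorem leftSum_le {n : ℕ} {π σ : Equiv.Perm (Fin n)}
    (h : ∀ i, firstLabel π (π i) = firstLabel π (σ i)) : leftSum σ ≤ leftSum π ∧
      (leftSum σ = leftSum π → ∀ i, firstLabel π (σ i) = firstLabel σ (σ i)) := by
  rw [leftSum_eq h]
  have hle : ∀ i ∈ Finset.univ, (if σ i ≤ i then 2 * (σ i : ℕ) else 2 * i + 1) ≤
      if firstLabel π (σ i) = 1 then 2 * (σ i : ℕ) else 2 * i + 1 := by
    intro i _
    split_ifs <;> omega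
  refine ⟨Finset.sum_le_sum hle, fun heq i => ?_⟩
  have h1 := (Finset.sum_eq_sum_iff_of_le hle).1 heq i (Finset.mem_univ i)
  rw [firstLabel_apply]
  split_ifs at h1 ⊢ <;> omega

theorem eq_of_firstLabel_eq {n : ℕ} {p q : Setoid (Fin n)} (hp : NonCrossing p) (hq : NonCrossing q)
    (h : ∀ i, firstLabel (succPerm p) (succPerm p i) = firstLabel (succPerm p) (succPerm q i))
    (heq : leftSum (succPerm q) = leftSum (succPerm p)) : p = q := by
  have h1 := (leftSum_le h).2 heq
  have hL : firstLabel (succPerm p) = firstLabel (succPerm q) := by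
    ext1 j
    have := h1 ((succPerm q).symm j)
    rwa [Equiv.apply_symm_apply] at this
  refine hp.eq_of_first_last hq (fun j => ?_) fun i => ?_
  · rw [exists_lt_rel_iff, exists_lt_rel_iff, not_iff_not]
    have := congrFun hL j
    unfold firstLabel at this
    grind
  · rw [exists_gt_rel_iff, exists_gt_rel_iff, not_iff_not]
    have := (h i).trans (h1 i)
    rw [firstLabel_apply, firstLabel_apply] at this
    grind

/-- The second labelling is the pullback of the first one along the successor map of `p`. -/
def IsPullback {n : ℕ} (p : Setoid (Fin n)) (y : (Fin n → Fin 2) × (Fin n → Fin 2)) : Prop :=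
  ∀ i, y.2 i = y.1 (succPerm p i)

-- Test the relation on the labelling built from a `p` of least left sum among those with nonzero
-- coefficient. A further `q` compatible with this labelling has left sum at most that of `p`, hence
-- equal to it by minimality, and then `q = p`.
open Classical in
theorem coeff_eq_zero_of_succPerm {n : ℕ} {s : Finset (Setoid (Fin n))}
    (hs : ∀ p ∈ s, NonCrossing p) {d : Setoid (Fin n) → ℂ}
    (h : ∀ y : (Fin n → Fin 2) × (Fin n → Fin 2),
      ∑ p ∈ s, d p * (if IsPullback p y then 1 else 0) = 0) :
    ∀ p ∈ s, d p = 0 := by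
  by_contra! hne
  obtain ⟨p₀, hp₀, hd₀⟩ := hne
  obtain ⟨p, hp, hmin⟩ := Finset.exists_min_image (s.filter fun p => d p ≠ 0)
    (fun p => leftSum (succPerm p)) ⟨p₀, Finset.mem_filter.2 ⟨hp₀, hd₀⟩⟩
  rw [Finset.mem_filter] at hp
  have h1 := h (firstLabel (succPerm p), fun i => firstLabel (succPerm p) (succPerm p i))
  rw [Finset.sum_eq_single_of_mem p hp.1] at h1
  · exact hp.2 (by simpa [IsPullback] using h1)
  · intro q hq hqp
    by_cases hd : d q = 0
    · simp [hd]
    rw [if_neg, mul_zero]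
    intro hc
    exact hqp (eq_of_firstLabel_eq (hs p hp.1) (hs q hq) hc
      (le_antisymm (leftSum_le hc).1 (hmin q (Finset.mem_filter.2 ⟨hq, hd⟩)))).symm

open Classical in
theorem sum_indicator_mul_conj {ι X : Type} [Fintype X] (s : Finset ι) (c : ι → ℂ)
    (P : ι → X → Prop) :
    ∑ x, (∑ p ∈ s, c p * (if P p x then 1 else 0)) *
        (starRingEnd ℂ) (∑ p ∈ s, c p * (if P p x then 1 else 0))
      = ∑ p ∈ s, ∑ q ∈ s, c p * (starRingEnd ℂ) (c q) * Nat.card {x // P p x ∧ P q x} := by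
  simp only [map_sum, Finset.sum_mul_sum]
  rw [Finset.sum_comm]
  refine Finset.sum_congr rfl fun p _ => ?_
  rw [Finset.sum_comm]
  refine Finset.sum_congr rfl fun q _ => ?_
  rw [Nat.card_eq_fintype_card, Fintype.card_subtype, Finset.card_filter, Nat.cast_sum,
    Finset.mul_sum]
  refine Finset.sum_congr rfl fun x _ => ?_
  by_cases h1 : P p x <;> by_cases h2 : P q x <;> simp [h1, h2]

theorem eq_zero_of_sum_mul_conj {X : Type} [Fintype X] {f : X → ℂ}
    (h : ∑ x, f x * (starRingEnd ℂ) (f x) = 0) (x : X) : f x = 0 := by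
  simp only [Complex.mul_conj, ← Complex.ofReal_sum] at h
  rw [Complex.ofReal_eq_zero, Finset.sum_eq_zero_iff_of_nonneg fun x _ => Complex.normSq_nonneg _]
    at h
  exact Complex.normSq_eq_zero.1 (h x (Finset.mem_univ x))

theorem card_graph_eq_agreeCard {n : ℕ} (p q : Setoid (Fin n)) :
    Nat.card {y // IsPullback p y ∧ IsPullback q y} = agreeCard p q :=
  Nat.card_congr
    { toFun := fun y => ⟨y.1.1, fun j => (y.2.1 j).symm.trans (y.2.2 j)⟩
      invFun := fun x => ⟨(x.1, fun i => x.1 (succPerm p i)), fun _ => rfl, x.2⟩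
      left_inv := fun y => Subtype.ext (Prod.ext rfl (funext fun i => (y.2.1 i).symm))
      right_inv := fun _ => rfl }

theorem blockWeight_ne_zero {n : ℕ} (p : Setoid (Fin n)) : blockWeight p ≠ 0 := by
  have : Nonempty {x : Fin n → Fin 2 // ConstOn p x} := ⟨⟨fun _ => 0, fun _ _ _ => rfl⟩⟩
  exact Nat.card_pos.ne'

theorem gram_weighted {n : ℕ} {p q : Setoid (Fin n)} (hp : NonCrossing p) (hq : NonCrossing q)
    (a b : ℂ) : (blockWeight p * a) * (starRingEnd ℂ) (blockWeight q * b) * (agreeCard p q : ℂ)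
      = 2 ^ n * (a * (starRingEnd ℂ) b * constCard 4 p q) := by
  have h : (2 : ℂ) ^ n * constCard 4 p q = blockWeight p * blockWeight q * agreeCard p q := by
    have := gramRel hp hq
    unfold GramRel at this
    exact_mod_cast this
  rw [map_mul, Complex.conj_natCast]
  linear_combination (-(a * (starRingEnd ℂ) b)) * h

open Classical in
/-- The indicators of the labellings by four labels that are compatible with a non-crossing
partition are linearly independent. -/
theorem coeff_eq_zero_of_constOn {n : ℕ} {s : Finset (Setoid (Fin n))}
    (hs : ∀ p ∈ s, NonCrossing p) {c : Setoid (Fin n) → ℂ}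
    (h : ∀ x : Fin n → Fin 4, ∑ p ∈ s, c p * (if ConstOn p x then 1 else 0) = 0) :
    ∀ p ∈ s, c p = 0 := by
  have h1 : ∑ p ∈ s, ∑ q ∈ s, c p * (starRingEnd ℂ) (c q) * (constCard 4 p q : ℂ) = 0 := by
    unfold constCard
    rw [← sum_indicator_mul_conj s c fun p (x : Fin n → Fin 4) => ConstOn p x]
    simp only [h, zero_mul, Finset.sum_const_zero]
  -- By the Gram relation this is 2^n times the form in `h1`, so the weighted two-label combination
  -- also has norm zero.
  have h2 : ∑ p ∈ s, ∑ q ∈ s, (blockWeight p * c p) *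
      (starRingEnd ℂ) (blockWeight q * c q) * (agreeCard p q : ℂ) = 0 := by
    rw [Finset.sum_congr rfl fun p hp => Finset.sum_congr rfl fun q hq =>
      gram_weighted (hs p hp) (hs q hq) (c p) (c q)]
    simp only [← Finset.mul_sum]
    rw [h1, mul_zero]
  have h3 := sum_indicator_mul_conj s (fun p => blockWeight p * c p) IsPullback
  simp only [card_graph_eq_agreeCard] at h3
  rw [h2] at h3
  intro p hp
  have := coeff_eq_zero_of_succPerm hs (eq_zero_of_sum_mul_conj h3) p hp
  exact (mul_eq_zero.1 this).resolve_left (Nat.cast_ne_zero.2 (blockWeight_ne_zero p))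

/-! ### Transfer to the maps `T_p` -/

/-- The points of a two-row partition, numbered in cyclic order. -/
def posEquiv (k l : ℕ) : Fin k ⊕ Fin l ≃ Fin (k + l) :=
  (Equiv.sumCongr (Equiv.refl _) Fin.revPerm).trans finSumFinEquiv

theorem posEquiv_val {k l : ℕ} (x : Fin k ⊕ Fin l) : (posEquiv k l x : ℕ) = Partition.pos x := by
  rcases x with a | b <;> simp [posEquiv, Partition.pos]

/-- The partition of the cyclically numbered points. -/
def Partition.flatten {k l : ℕ} (p : Partition k l) : Setoid (Fin (k + l)) :=
  p.comap (posEquiv k l).symm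

theorem Partition.flatten_apply {k l : ℕ} (p : Partition k l) (a b : Fin (k + l)) :
    p.flatten a b ↔ p ((posEquiv k l).symm a) ((posEquiv k l).symm b) := Iff.rfl

theorem Partition.flatten_injective {k l : ℕ} :
    Function.Injective (Partition.flatten : Partition k l → _) := by
  intro p q h
  ext x y
  have := Setoid.ext_iff.1 h (posEquiv k l x) (posEquiv k l y)
  rw [flatten_apply, flatten_apply] at this
  simpa only [Equiv.symm_apply_apply] using this

theorem Partition.IsNonCrossing.flatten {k l : ℕ} {p : Partition k l} (h : p.IsNonCrossing) :
    NonCrossing p.flatten := by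
  have hpos : ∀ a : Fin (k + l), Partition.pos ((posEquiv k l).symm a) = a := fun a => by
    rw [← posEquiv_val, Equiv.apply_symm_apply]
  intro a b c d hab hbc hcd hac hbd
  exact h _ _ _ _ (by rwa [hpos, hpos]) (by rwa [hpos, hpos]) (by rwa [hpos, hpos]) hac hbd

theorem Partition.isValid_iff {k l : ℕ} (p : Partition k l) {N m : ℕ} {f : Fin m → Fin N}
    (hf : Function.Injective f) (x : Fin (k + l) → Fin m) :
    p.IsValid (fun a => f (x (posEquiv k l (.inl a)))) (fun b => f (x (posEquiv k l (.inr b))))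
      ↔ ConstOn p.flatten x := by
  have e : Sum.elim (fun a => f (x (posEquiv k l (.inl a))))
      (fun b => f (x (posEquiv k l (.inr b)))) = fun z => f (x (posEquiv k l z)) := by
    ext1 z
    rcases z with a | b <;> rfl
  unfold Partition.IsValid ConstOn
  rw [e]
  simp only [hf.eq_iff, flatten_apply]
  constructor
  · intro h i j hij
    simpa using h _ _ hij
  · intro h y z hyz
    exact h _ _ (by simpa using hyz)

theorem Partition.repr_T {k l : ℕ} (N : ℕ) (p : Partition k l) (i : Fin k → Fin N)
    (j : Fin l → Fin N) : (tBasis N l).repr (p.T N (tBasis N k i)) j = p.delta i j := by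
  classical
  rw [Partition.T, Module.Basis.constr_basis]
  simp [Finsupp.single_apply]

/-- Matrix entries of `T_p` at indices among the first four basis vectors are the values of the
four-label indicator of `p.flatten`, so a relation among the maps restricts to one among the
indicators. -/
theorem linearIndependent_T {N : ℕ} (hN : 4 ≤ N) (k l : ℕ) :
    LinearIndependent ℂ
      fun p : {p : Partition k l // p.IsNonCrossing} => Partition.T N p.1 := by
  classical
  rw [linearIndependent_iff']
  intro s c hc p hp
  have inj : Function.Injective
      (fun p : {p : Partition k l // p.IsNonCrossing} => p.1.flatten) :=
    Partition.flatten_injective.comp Subtype.val_injective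
  have key := coeff_eq_zero_of_constOn (s := s.map ⟨_, inj⟩)
    -- The coefficients are carried along the injective flattening; the default 0 is never met, as
    -- the sum runs over flattened partitions only.
    (c := Function.extend (fun p : {p : Partition k l // p.IsNonCrossing} => p.1.flatten) c 0)
    (by
      intro q hq
      obtain ⟨p, -, rfl⟩ := Finset.mem_map.1 hq
      exact p.2.flatten)
    (by
      intro x
      rw [Finset.sum_map]
      simp only [Function.Embedding.coeFn_mk, inj.extend_apply]
      have h1 := congrArg (fun S => (tBasis N l).repr (S (tBasis N k
        fun a => Fin.castLE hN (x (posEquiv k l (.inl a)))))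
        fun b => Fin.castLE hN (x (posEquiv k l (.inr b)))) hc
      simp only [LinearMap.sum_apply, LinearMap.smul_apply, map_sum, map_smul,
        Finsupp.coe_finsetSum, Finset.sum_apply, Finsupp.smul_apply, Partition.repr_T,
        LinearMap.zero_apply, map_zero, Finsupp.zero_apply, smul_eq_mul] at h1
      refine Eq.trans ?_ h1
      refine Finset.sum_congr rfl fun p _ => ?_
      unfold Partition.delta
      simp only [Partition.isValid_iff _ (Fin.castLE_injective hN)])
    p.1.flatten (Finset.mem_map.2 ⟨p, hp, rfl⟩)
  rwa [inj.extend_apply] at key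

theorem mem_of_T_mem {N : ℕ} (hN : 4 ≤ N) {C : PartitionCategory} (hC : C.IsNonCrossing)
    {k l : ℕ} {p : Partition k l} (hp : p.IsNonCrossing) (h : Partition.T N p ∈ R N C k l) :
    p ∈ C.mem k l := by
  by_contra hnot
  refine (linearIndependent_T hN k l).notMem_span_image
    (s := {q : {p : Partition k l // p.IsNonCrossing} | q.1 ∈ C.mem k l}) (x := ⟨p, hp⟩) hnot ?_
  refine Submodule.span_mono ?_ h
  rintro _ ⟨q, hq, rfl⟩
  exact ⟨⟨q, hC k l q hq⟩, hq, rfl⟩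

theorem injOn_R {N : ℕ} (hN : 4 ≤ N) :
    Set.InjOn (R N) {C : PartitionCategory | C.IsNonCrossing} := by
  have main : ∀ {C D : PartitionCategory}, C.IsNonCrossing → D.IsNonCrossing → R N C = R N D →
      ∀ k l p, p ∈ C.mem k l → p ∈ D.mem k l := by
    intro C D hC hD h k l p hp
    refine mem_of_T_mem hN hD (hC k l p hp) ?_
    rw [← h]
    exact Submodule.subset_span ⟨p, hp, rfl⟩
  intro C hC D hD h
  ext k l p
  exact ⟨main hC hD h k l p, main hD hC h.symm k l p⟩

end EasyQG

/-! ### Injectivity and its consequence for quantum groups -/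

theorem mainTheorem6 (N : ℕ) (hN : 4 ≤ N) :
    Set.InjOn (EasyQG.R N) {C : EasyQG.PartitionCategory | C.IsNonCrossing} ∧
    ∀ C₁ C₂ : EasyQG.PartitionCategory, C₁.IsNonCrossing → C₂.IsNonCrossing → C₁ ≠ C₂ →
      ∀ (G₁ : EasyQG.OrthogonalCMQG.{u} N) (G₂ : EasyQG.OrthogonalCMQG.{v} N),
        G₁.IsEasy C₁ → G₂.IsEasy C₂ → ¬ G₁.Same G₂ := by
  refine ⟨EasyQG.injOn_R hN, fun C₁ C₂ h₁ h₂ hne G₁ G₂ e₁ e₂ hsame => hne ?_⟩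
  refine EasyQG.injOn_R hN h₁ h₂ ?_
  ext1 k
  ext1 l
  rw [← e₁ k l, ← e₂ k l, hsame k l]
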